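/- Define words over the alphabet $\{a,b\}$ by $\zeta_i(0)=a$ and $\zeta_i(i)=b$ for all $i\ge 1$, and $\zeta_i(j)=\zeta_{i-1}(j)\,\zeta_{i-1}(j-1)$ (concatenation) for all $i\ge 2$ and $0<j<i$. Let $\mathcal L(\zeta)$ be the set of all finite words that occur as (contiguous) subwords of some $\zeta_i(j)$ with $i\ge 1$ and $0\le j\le i$. Let $\Sigma\subset\{a,b\}^{\mathbb Z}$ be the set of all two-sided sequences all of whose finite subwords belong to $\mathcal L(\zeta)$, with the topology induced by the product topology, and let $\sigma:\Sigma\to\Sigma$, $(\sigma x)_n=x_{n+1}$, be the shift, which is a homeomorphism of the compact metrizable space $\Sigma$. Theorem. The system $(\Sigma,\sigma)$ is topologically weakly mixing; that is, the product system $(\Sigma\times\Sigma,\sigma\times\sigma)$ is topologically ergodic: there is a point $(x,y)\in\Sigma\times\Sigma$ whose orbit $\{(\sigma^n x,\sigma^n y): n\in\mathbb Z\}$ is dense in $\Sigma\times\Sigma$. -/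

import Mathlib

/-- The two-letter alphabet `{a, b}`, with the discrete topology. -/
inductive PascalLetter : Type
  | a : PascalLetter
  | b : PascalLetter

namespace PascalLetter

instance : TopologicalSpace PascalLetter := ⊥

instance : DiscreteTopology PascalLetter := ⟨rfl⟩

instance : Finite PascalLetter :=
  Finite.of_surjective (fun t : Bool => if t then a else b) (by
    rintro (_ | _)
    · exact ⟨true, rfl⟩
    · exact ⟨false, rfl⟩)

end PascalLetter

/-! General topological dynamics. A topological dynamical system is a compact metrizable space
together with a homeomorphism of it onto itself. -/

/-- Topological ergodicity (topological transitivity): some point has a dense two-sided orbit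
`{T ^ n x : n ∈ ℤ}`. -/
def IsTopologicallyErgodic {X : Type*} [TopologicalSpace X] [CompactSpace X]
    [TopologicalSpace.MetrizableSpace X] (T : X ≃ₜ X) : Prop :=
  ∃ x : X, Dense (Set.range fun n : ℤ => (T ^ n) x)

/-- Topological weak mixing: the product system `(X × X, T × T)` is topologically ergodic. -/
def IsTopologicallyWeaklyMixing {X : Type*} [TopologicalSpace X] [CompactSpace X]
    [TopologicalSpace.MetrizableSpace X] (T : X ≃ₜ X) : Prop :=
  IsTopologicallyErgodic (T.prodCongr T)

namespace PascalSubshift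

/-- The basic word `zeta i j`, meaningful for `1 ≤ i` and `0 ≤ j ≤ i`:
`zeta i 0 = a`, `zeta i i = b`, and `zeta i j = zeta (i - 1) j ++ zeta (i - 1) (j - 1)` for
`0 < j < i`. (It is the empty word for `i = 0` and for `j > i`; these values are never used.) -/
def zeta : ℕ → ℕ → List PascalLetter
  | 0, _ => []
  | _ + 1, 0 => [PascalLetter.a]
  | i + 1, j + 1 => if j = i then [PascalLetter.b] else zeta i (j + 1) ++ zeta i j

/-- The language: all (contiguous) subwords of all basic words `zeta i j`, `i ≥ 1`, `0 ≤ j ≤ i`. -/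
def language : Set (List PascalLetter) :=
  {w | ∃ i j : ℕ, 1 ≤ i ∧ j ≤ i ∧ w <:+: zeta i j}

/-- The word `x m, x (m + 1), …, x (m + n - 1)` of a two-sided sequence `x`. -/
def subword (x : ℤ → PascalLetter) (m : ℤ) (n : ℕ) : List PascalLetter :=
  List.ofFn fun k : Fin n => x (m + (k : ℕ))

/-- The two-sided sequences on `{a, b}` all of whose finite subwords belong to the language. -/
def sequences : Set (ℤ → PascalLetter) :=
  {x | ∀ (m : ℤ) (n : ℕ), subword x m n ∈ language}

/-- The left shift `(σ x) n = x (n + 1)` on all two-sided sequences, with the product topology. -/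
def fullShift : (ℤ → PascalLetter) ≃ₜ (ℤ → PascalLetter) where
  toFun x n := x (n + 1)
  invFun x n := x (n - 1)
  left_inv x := by funext n; simp
  right_inv x := by funext n; simp
  continuous_toFun := by fun_prop
  continuous_invFun := by fun_prop

theorem subword_fullShift (x : ℤ → PascalLetter) (m : ℤ) (n : ℕ) :
    subword (fullShift x) m n = subword x (m + 1) n := by
  unfold subword
  congr 1
  funext k
  change x (m + (k : ℕ) + 1) = x (m + 1 + (k : ℕ))
  congr 1
  ring

theorem mem_sequences_iff_fullShift (x : ℤ → PascalLetter) :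
    x ∈ sequences ↔ fullShift x ∈ sequences := by
  constructor
  · intro h m n
    rw [subword_fullShift]
    exact h (m + 1) n
  · intro h m n
    have := h (m - 1) n
    rwa [subword_fullShift, sub_add_cancel] at this

theorem isClosed_sequences : IsClosed sequences := by
  have h : sequences = ⋂ (m : ℤ) (n : ℕ),
      (fun (x : ℤ → PascalLetter) (k : Fin n) => x (m + (k : ℕ))) ⁻¹'
        {v : Fin n → PascalLetter | List.ofFn v ∈ language} := by
    ext x
    simp [sequences, subword]
  rw [h]
  refine isClosed_iInter fun m => isClosed_iInter fun n => ?_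
  exact (isClosed_discrete _).preimage (by fun_prop)

instance : CompactSpace sequences := isCompact_iff_compactSpace.mp isClosed_sequences.isCompact

/-- The homeomorphism `σ : Σ → Σ` obtained by restricting the shift. -/
def shift : sequences ≃ₜ sequences :=
  fullShift.subtype mem_sequences_iff_fullShift

end PascalSubshift

/-!
Every nonempty open set of `Σ` contains the sequences that carry a given word of the language at a
given place, and any finitely many words of the language occur together in one basic word
`w = zeta n k` with `0 < k < n`. Let `D` be the set of differences between the positions of two
occurrences of `w` in one word of the language (`gaps w`). By Baire's theorem
(`exists_dense_zpow_orbit`) and the extension of words to points of `Σ` (`exists_mem_sequences`),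
weak mixing reduces to the statement that `D ∩ (D - c)` is nonempty for every integer `c`
(`exists_add_mem_gaps`).

To prove this, let `S M` be the set of occurrences of `w` in the central word `zeta (2 * M) M`, and
measure families of finite sets of integers by their density relative to the length of that word,
in the limit along an ultrafilter. Call a finite set `F ⊆ ℤ` admissible if a translate of it
consists of occurrences of `w` in one word of the language, and let `s` be the supremum of the
densities of `S - F` over the admissible `F`. If `zeta n' k'` contains a word that witnesses the
admissibility of `F`, and `j` is a gap of `zeta n' k'`, then `F ∪ (F + j)` is admissible, so
`S - F` and `S - F - j` together have density at most `s`. When the density of `S - F` is close to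
`s`, the set `S - F` is therefore almost invariant under translation by `j`. Along an increasing
sequence of admissible sets with densities tending to `s`, the density of
`(S - F) \ (S - F + e)` tends to a translation-invariant pseudonorm `N e` on `ℤ`, which is small on
the gaps of suitable words `zeta n' k'`.

Two properties of these gaps finish the proof. Occurrences of `zeta n' k'` have positive density,
so every sequence of integers has two terms that differ by a gap (`exists_sub_mem_gaps`); thus `N`
is totally bounded. All binomial coefficients `m.choose k'` with `m ≥ n'` are gaps
(`choose_mem_gaps`). A polynomial recurrence argument in the style of Weyl (`exists_choose_small`)
gives large `t` with `N (t.choose j)` tiny for `1 ≤ j ≤ k'`, and by Vandermonde's identity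
`(k' + t).choose k'` is then almost `1` with respect to `N`. Hence `N 1 = 0`, and so `N c = 0` for
every `c`. If `D ∩ (D - c)` were empty, then `S - F` would be disjoint from its translate by `c` for
every admissible `F`, and `N c` would be at least the density of `S`, which is positive.
-/

open Filter Topology Pointwise

/-! ### Polynomial recurrence for totally bounded pseudonorms on the integers -/

theorem norm_sum_le_sum_of_subadditive {N : ℤ → ℝ} (h0 : N 0 = 0)
    (hadd : ∀ x y, N (x + y) ≤ N x + N y) {ι : Type*} (s : Finset ι) (f : ι → ℤ) :
    N (∑ i ∈ s, f i) ≤ ∑ i ∈ s, N (f i) := by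
  classical
  induction s using Finset.induction_on with
  | empty => simp [h0]
  | insert a s ha ih =>
    rw [Finset.sum_insert ha, Finset.sum_insert ha]
    exact (hadd _ _).trans (by linarith)

theorem norm_natCast_mul_le_of_subadditive {N : ℤ → ℝ} (h0 : N 0 = 0)
    (hadd : ∀ x y, N (x + y) ≤ N x + N y) (n : ℕ) (x : ℤ) : N (n * x) ≤ n * N x := by
  have := norm_sum_le_sum_of_subadditive h0 hadd (Finset.range n) (fun _ => x)
  simpa using this

/-- Up to the mixed terms of Vandermonde's identity, `t ↦ t.choose j` is additive. The factor
`2 ^ u` bounds the binomial coefficients of `u`. -/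
theorem norm_choose_add_sub_le {N : ℤ → ℝ} (h0 : N 0 = 0)
    (hadd : ∀ x y, N (x + y) ≤ N x + N y) {u t j : ℕ} (hj : 1 ≤ j) {τ : ℝ} (hτ : 0 ≤ τ)
    (h : ∀ i, 1 ≤ i → i < j → N (t.choose i : ℤ) ≤ τ) :
    N (((u + t).choose j : ℤ) - (u.choose j : ℤ) - (t.choose j : ℤ)) ≤ j * 2 ^ u * τ := by
  have e : (((u + t).choose j : ℤ) - (u.choose j : ℤ) - (t.choose j : ℤ)) =
      ∑ i ∈ Finset.range (j - 1), ((u.choose (j - (i + 1)) : ℕ) : ℤ) * (t.choose (i + 1) : ℤ) := by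
    obtain ⟨j, rfl⟩ : ∃ l, j = l + 1 := ⟨j - 1, by omega⟩
    rw [add_comm u t, Nat.add_choose_eq, Finset.Nat.sum_antidiagonal_eq_sum_range_succ
      (fun a b => t.choose a * u.choose b), Finset.sum_range_succ, Finset.sum_range_succ']
    push_cast
    simp [mul_comm]
    ring
  rw [e]
  refine (norm_sum_le_sum_of_subadditive h0 hadd _ _).trans ?_
  have hb : ∀ i ∈ Finset.range (j - 1),
      N (((u.choose (j - (i + 1)) : ℕ) : ℤ) * (t.choose (i + 1) : ℤ)) ≤ 2 ^ u * τ := by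
    intro i hi
    rw [Finset.mem_range] at hi
    refine (norm_natCast_mul_le_of_subadditive h0 hadd _ _).trans ?_
    have h1 : ((u.choose (j - (i + 1)) : ℕ) : ℝ) ≤ 2 ^ u := by
      exact_mod_cast Nat.choose_le_two_pow _ _
    have h2 := h (i + 1) (by omega) (by omega)
    calc _ ≤ ((u.choose (j - (i + 1)) : ℕ) : ℝ) * τ := by gcongr
      _ ≤ _ := by gcongr
  refine (Finset.sum_le_sum hb).trans ?_
  rw [Finset.sum_const, Finset.card_range, nsmul_eq_mul, mul_assoc]
  gcongr
  omega

/-- Recurrence: for a totally bounded pseudonorm on `ℤ`, the binomial coefficients `t.choose j`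
with `1 ≤ j ≤ k` are simultaneously small for arbitrarily large `t`. In the induction on `k`,
numbers for which the coefficients below the top one are tiny are added up one after the other;
the top coefficients of such sums are nearly additive, so total boundedness, applied to their
partial sums, yields a block whose top coefficient is small as well. -/
theorem exists_choose_small {N : ℤ → ℝ} (h0 : N 0 = 0)
    (hadd : ∀ x y, N (x + y) ≤ N x + N y)
    (htb : ∀ η > 0, ∀ s : ℕ → ℤ, ∃ a b, a < b ∧ N (s b - s a) ≤ η) (k : ℕ) :
    ∀ η > 0, ∀ T₀ : ℕ, ∃ t ≥ T₀, ∀ j, 1 ≤ j → j ≤ k → N (t.choose j : ℤ) ≤ η := by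
  induction k with
  | zero => exact fun η _ T₀ => ⟨T₀, le_rfl, fun j h1 h2 => by omega⟩
  | succ k ih =>
    intro η hη T₀
    have hstep : ∀ (b x : ℕ), ∃ y, x + (T₀ + 1) ≤ y ∧ ∀ j, 1 ≤ j → j ≤ k →
        N ((y - x).choose j : ℤ) ≤ η / 2 ^ (b + 2) / ((k + 2) * 2 ^ x) := by
      intro b x
      obtain ⟨t, ht, h⟩ := ih (η / 2 ^ (b + 2) / ((k + 2) * 2 ^ x)) (by positivity) (T₀ + 1)
      exact ⟨x + t, by omega, by simpa using h⟩
    choose f hf hfN using hstep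
    -- The steps `T (b + 1) - T b` are the numbers that are added up, each chosen with a tolerance
    -- that depends on all the previous ones.
    set T : ℕ → ℕ := fun b => Nat.rec 0 (fun b x => f b x) b with hT
    have hTs : ∀ b, T (b + 1) = f b (T b) := fun b => rfl
    have hTmono : ∀ b, T b + (T₀ + 1) ≤ T (b + 1) := fun b => by rw [hTs]; exact hf _ _
    have hmono : StrictMono T := strictMono_nat_of_lt_succ fun b => by have := hTmono b; omega
    -- The partial sums of the top coefficients.
    set s : ℕ → ℤ := fun b => ∑ i ∈ Finset.range b, ((T (i + 1) - T i).choose (k + 1) : ℤ) with hs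
    -- The errors of the block from `a` to `b` sum to at most a segment of a geometric series.
    have key : ∀ a b, a ≤ b → ∀ j, 1 ≤ j → j ≤ k + 1 →
        N (((T b - T a).choose j : ℤ) - if j = k + 1 then s b - s a else 0) ≤
          η * (1 / 2 ^ (a + 1) - 1 / 2 ^ (b + 1)) := by
      intro a b hab
      induction b, hab using Nat.le_induction with
      | base =>
        intro j hj _
        have : (0 : ℕ).choose j = 0 := Nat.choose_eq_zero_of_lt hj
        simp [this, h0]
      | succ b hab ihb =>
        intro j hj hjk
        have hle : T a ≤ T b := hmono.monotone hab
        have hle' := hTmono b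
        set u := T b - T a with hu
        set t := T (b + 1) - T b with ht
        have hsplit : T (b + 1) - T a = u + t := by omega
        set τ := η / 2 ^ (b + 2) / ((k + 2) * 2 ^ T b) with hτ
        have hτ0 : 0 ≤ τ := by positivity
        have htN : ∀ i, 1 ≤ i → i ≤ k → N (t.choose i : ℤ) ≤ τ := by
          intro i h1 h2
          rw [ht, hTs]
          exact hfN b (T b) i h1 h2
        have hcross := norm_choose_add_sub_le h0 hadd (u := u) (t := t) hj hτ0
          (fun i h1 h2 => htN i h1 (by omega))
        have hpow : (2 : ℝ) ^ u ≤ 2 ^ T b := pow_le_pow_right₀ (by norm_num) (by omega)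
        have hone : (1 : ℝ) ≤ 2 ^ T b := one_le_pow₀ (by norm_num)
        have hτη : (k + 2) * 2 ^ T b * τ = η / 2 ^ (b + 2) := by
          rw [hτ]; field_simp
        have hlast : η / 2 ^ (b + 2) + η * (1 / 2 ^ (a + 1) - 1 / 2 ^ (b + 1)) =
            η * (1 / 2 ^ (a + 1) - 1 / 2 ^ (b + 1 + 1)) := by
          rw [pow_succ 2 (b + 1)]; field_simp; ring
        rw [← hlast, hsplit, ← hτη]
        have hjk' : (j : ℝ) ≤ k + 1 := by exact_mod_cast hjk
        by_cases hc : j = k + 1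
        · have hsb : s (b + 1) = s b + (t.choose (k + 1) : ℤ) := by
            simp only [hs, Finset.sum_range_succ, ht]
          have := ihb j hj hjk
          rw [if_pos hc] at this ⊢
          have e : (((u + t).choose j : ℕ) : ℤ) - (s (b + 1) - s a) =
              (((u + t).choose j : ℤ) - (u.choose j : ℤ) - (t.choose j : ℤ)) +
                ((u.choose j : ℤ) - (s b - s a)) := by
            rw [hsb, hc]; ring
          rw [e]
          refine (hadd _ _).trans (add_le_add (hcross.trans ?_) this)
          gcongr
          linarith
        · have := ihb j hj hjk
          rw [if_neg hc] at this ⊢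
          have e : (((u + t).choose j : ℕ) : ℤ) - 0 =
              (((u + t).choose j : ℤ) - (u.choose j : ℤ) - (t.choose j : ℤ)) +
                (t.choose j : ℤ) + ((u.choose j : ℤ) - 0) := by ring
          rw [e]
          refine (hadd _ _).trans (add_le_add ((hadd _ _).trans ?_) this)
          have h1 := htN j hj (by omega)
          have h2 : (j : ℝ) * 2 ^ u * τ ≤ (k + 1) * 2 ^ T b * τ := by gcongr
          have h3 : τ ≤ 2 ^ T b * τ := le_mul_of_one_le_left hτ0 hone
          linarith
    obtain ⟨a, b, hab, hN⟩ := htb (η / 2) (by positivity) s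
    refine ⟨T b - T a, ?_, ?_⟩
    · have h1 := hTmono a
      have h2 : T (a + 1) ≤ T b := hmono.monotone hab
      omega
    · intro j hj hjk
      have h := key a b hab.le j hj hjk
      have hpos : (0 : ℝ) < 1 / 2 ^ (b + 1) := by positivity
      have ha : (1 : ℝ) / 2 ^ (a + 1) ≤ 1 / 2 := by
        rw [pow_succ]
        have : (1 : ℝ) ≤ 2 ^ a := one_le_pow₀ (by norm_num)
        rw [div_le_div_iff₀ (by positivity) (by norm_num)]
        linarith
      have hb : η * (1 / 2 ^ (a + 1) - 1 / 2 ^ (b + 1)) ≤ η * (1 / 2) := by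
        gcongr; linarith
      have e : (((T b - T a).choose j : ℕ) : ℤ) =
          (((T b - T a).choose j : ℤ) - if j = k + 1 then s b - s a else 0) +
            if j = k + 1 then s b - s a else 0 := by ring
      rw [e]
      refine (hadd _ _).trans ?_
      have : N (if j = k + 1 then s b - s a else 0) ≤ η / 2 := by
        split_ifs
        · exact hN
        · rw [h0]; positivity
      linarith

/-- The step from binomial coefficients to `1`: for `t` as in `exists_choose_small`, the number
`(k + t).choose k = ∑ j, k.choose j * t.choose j` is close to its term `j = 0`, which is `1`. -/
theorem norm_one_le_of_choose {N : ℤ → ℝ} (h0 : N 0 = 0) (hneg : ∀ x, N (-x) = N x)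
    (hadd : ∀ x y, N (x + y) ≤ N x + N y)
    (htb : ∀ η > 0, ∀ s : ℕ → ℤ, ∃ a b, a < b ∧ N (s b - s a) ≤ η) {k n : ℕ} {ε : ℝ}
    (h : ∀ m ≥ n, N (m.choose k : ℤ) ≤ ε) : N 1 ≤ ε := by
  refine le_of_forall_pos_le_add fun η hη => ?_
  obtain ⟨t, htn, ht⟩ := exists_choose_small h0 hadd htb k (η / ((k + 1) * 2 ^ k))
    (by positivity) n
  set τ := η / ((k + 1) * 2 ^ k) with hτ
  have hτ0 : 0 ≤ τ := by positivity
  have h1 : N (((k + t).choose k : ℤ) - 1) ≤ η := by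
    rcases Nat.eq_zero_or_pos k with rfl | hk
    · simp [h0, hη.le]
    have hc := norm_choose_add_sub_le h0 hadd (u := k) (t := t) hk hτ0
      (fun i h1 h2 => ht i h1 h2.le)
    have e : ((k + t).choose k : ℤ) - 1 =
      (((k + t).choose k : ℤ) - (k.choose k : ℤ) - (t.choose k : ℤ)) + (t.choose k : ℤ) := by
      simp
    rw [e]
    refine (hadd _ _).trans ?_
    have h2 := ht k hk le_rfl
    have h3 : (k + 1) * 2 ^ k * τ = η := by rw [hτ]; field_simp
    have h4 : τ ≤ 2 ^ k * τ := le_mul_of_one_le_left hτ0 (one_le_pow₀ (by norm_num))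
    linarith
  have e : (1 : ℤ) = ((k + t).choose k : ℤ) + -(((k + t).choose k : ℤ) - 1) := by ring
  rw [e]
  refine (hadd _ _).trans ?_
  rw [hneg]
  exact add_le_add (h _ (by omega)) h1

/-! ### Densities of families of finite sets of integers -/

/-- The limit of a real sequence along a fixed free ultrafilter; a junk value for unbounded
sequences. -/
noncomputable def ultraLim (f : ℕ → ℝ) : ℝ := limUnder (hyperfilter ℕ : Filter ℕ) f

theorem tendsto_ultraLim {f : ℕ → ℝ} {C : ℝ} (h : ∀ n, f n ∈ Set.Icc 0 C) :
    Tendsto f (hyperfilter ℕ : Filter ℕ) (𝓝 (ultraLim f)) := by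
  refine tendsto_nhds_limUnder ?_
  obtain ⟨x, -, hx⟩ := (isCompact_Icc (a := (0 : ℝ)) (b := C)).ultrafilter_le_nhds
    ((hyperfilter ℕ).map f) (by
      rw [Ultrafilter.coe_map, le_principal_iff]
      exact Filter.mem_map.2 (Filter.univ_mem' h))
  exact ⟨x, hx⟩

namespace FinsetDensity

variable {ℓ : ℕ → ℕ}

/-- The density of a family of finite sets, relative to the lengths `ℓ`. -/
noncomputable def dens (ℓ : ℕ → ℕ) (E : ℕ → Finset ℤ) : ℝ :=
  ultraLim fun M => ((E M).card : ℝ) / ℓ M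

/-- The relative sizes are bounded, so that the limit defining `dens ℓ E` exists. -/
def IsBounded (ℓ : ℕ → ℕ) (E : ℕ → Finset ℤ) : Prop := ∃ C : ℕ, ∀ M, (E M).card ≤ C * ℓ M

theorem IsBounded.of_card_le {E E' : ℕ → Finset ℤ} (h' : IsBounded ℓ E')
    (h : ∀ M, (E M).card ≤ (E' M).card) : IsBounded ℓ E := by
  obtain ⟨C, hC⟩ := h'
  exact ⟨C, fun M => (h M).trans (hC M)⟩

theorem IsBounded.tendsto {E : ℕ → Finset ℤ} (h : IsBounded ℓ E) :
    Tendsto (fun M => ((E M).card : ℝ) / ℓ M) (hyperfilter ℕ : Filter ℕ) (𝓝 (dens ℓ E)) := by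
  obtain ⟨C, hC⟩ := h
  refine tendsto_ultraLim (C := C) fun M => ⟨by positivity, ?_⟩
  refine div_le_of_le_mul₀ (by positivity) (by positivity) ?_
  exact_mod_cast hC M

theorem dens_congr {E E' : ℕ → Finset ℤ} (h : ∀ M, (E M).card = (E' M).card) :
    dens ℓ E = dens ℓ E' := by
  simp only [dens, h]

theorem dens_nonneg {E : ℕ → Finset ℤ} (h : IsBounded ℓ E) : 0 ≤ dens ℓ E :=
  ge_of_tendsto' h.tendsto fun M => by positivity

theorem dens_mono {E E' : ℕ → Finset ℤ} (h : IsBounded ℓ E) (h' : IsBounded ℓ E')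
    (hle : ∀ M, (E M).card ≤ (E' M).card) : dens ℓ E ≤ dens ℓ E' :=
  le_of_tendsto_of_tendsto' h.tendsto h'.tendsto fun M => by
    have := hle M
    gcongr

theorem dens_le_add {E E' E'' : ℕ → Finset ℤ} (h : IsBounded ℓ E) (h' : IsBounded ℓ E')
    (h'' : IsBounded ℓ E'') (hle : ∀ M, (E M).card ≤ (E' M).card + (E'' M).card) :
    dens ℓ E ≤ dens ℓ E' + dens ℓ E'' :=
  le_of_tendsto_of_tendsto' h.tendsto (h'.tendsto.add h''.tendsto) fun M => by
    rw [← add_div]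
    have : ((E M).card : ℝ) ≤ (E' M).card + (E'' M).card := by exact_mod_cast hle M
    gcongr

theorem dens_eq_add {E E' E'' : ℕ → Finset ℤ} (h' : IsBounded ℓ E')
    (h'' : IsBounded ℓ E'') (he : ∀ M, (E M).card = (E' M).card + (E'' M).card) :
    dens ℓ E = dens ℓ E' + dens ℓ E'' := by
  obtain ⟨C, hC⟩ := h'
  obtain ⟨C', hC'⟩ := h''
  have h : IsBounded ℓ E := ⟨C + C', fun M => by
    rw [he, add_mul]; exact add_le_add (hC M) (hC' M)⟩
  refine tendsto_nhds_unique h.tendsto (Tendsto.congr (fun M => ?_)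
    ((IsBounded.tendsto ⟨C, hC⟩).add (IsBounded.tendsto ⟨C', hC'⟩)))
  rw [← add_div, he]
  push_cast
  rfl

/-- The density of the part of `S - F` outside its translate by `e`: half the density of the
symmetric difference of the two sets. -/
noncomputable def defect (ℓ : ℕ → ℕ) (S : ℕ → Finset ℤ) (F : Finset ℤ) (e : ℤ) : ℝ :=
  dens ℓ fun M => (S M - F) \ (S M - F + {e})

variable {S : ℕ → Finset ℤ}

theorem isBounded_sub (hS : ∀ M, S M ⊆ Finset.Ico 0 (ℓ M : ℤ)) (F : Finset ℤ) :
    IsBounded ℓ fun M => S M - F := by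
  refine ⟨F.card, fun M => Finset.card_sub_le.trans ?_⟩
  rw [mul_comm]
  gcongr
  simpa using Finset.card_le_card (hS M)

theorem isBounded_defect (hS : ∀ M, S M ⊆ Finset.Ico 0 (ℓ M : ℤ)) (F : Finset ℤ) (e : ℤ) :
    IsBounded ℓ fun M => (S M - F) \ (S M - F + {e}) :=
  (isBounded_sub hS F).of_card_le fun _ => Finset.card_le_card Finset.sdiff_subset

theorem defect_nonneg (hS : ∀ M, S M ⊆ Finset.Ico 0 (ℓ M : ℤ)) (F : Finset ℤ) (e : ℤ) :
    0 ≤ defect ℓ S F e := dens_nonneg (isBounded_defect hS F e)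

theorem add_singleton_zero (B : Finset ℤ) : B + {0} = B := by
  ext x
  simp [Finset.mem_add]

theorem defect_zero (F : Finset ℤ) : defect ℓ S F 0 = 0 := by
  have h : Tendsto (fun _ : ℕ => (0 : ℝ)) (hyperfilter ℕ : Filter ℕ) (𝓝 0) := tendsto_const_nhds
  simpa only [defect, dens, ultraLim, add_singleton_zero, sdiff_self, Finset.bot_eq_empty,
    Finset.card_empty, Nat.cast_zero, zero_div] using h.limUnder_eq

theorem sdiff_add_singleton (A B : Finset ℤ) (e : ℤ) : (A \ B) + {e} = (A + {e}) \ (B + {e}) := by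
  ext x
  simp only [Finset.mem_sdiff, Finset.mem_add, Finset.mem_singleton, exists_eq_left]
  constructor
  · rintro ⟨y, ⟨hA, hB⟩, rfl⟩
    refine ⟨⟨y, hA, rfl⟩, ?_⟩
    rintro ⟨z, hz, hzy⟩
    exact hB (by rwa [add_right_cancel hzy] at hz)
  · rintro ⟨⟨y, hA, rfl⟩, h⟩
    exact ⟨y, ⟨hA, fun hB => h ⟨y, hB, rfl⟩⟩, rfl⟩

theorem add_singleton_add_singleton (A : Finset ℤ) (x y : ℤ) : A + {x} + {y} = A + {x + y} := by
  rw [add_assoc, Finset.singleton_add_singleton]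

theorem card_sdiff_add_neg_singleton (B : Finset ℤ) (e : ℤ) :
    (B \ (B + {-e})).card = (B \ (B + {e})).card := by
  have h1 : (B \ (B + {-e})) + {e} = (B + {e}) \ B := by
    rw [sdiff_add_singleton, add_singleton_add_singleton, neg_add_cancel,
      add_singleton_zero]
  rw [← Finset.card_add_singleton _ e, h1]
  exact Finset.card_sdiff_comm (Finset.card_add_singleton _ _)

theorem defect_neg (F : Finset ℤ) (e : ℤ) : defect ℓ S F (-e) = defect ℓ S F e :=
  dens_congr fun _ => card_sdiff_add_neg_singleton _ _

theorem defect_add_le (hS : ∀ M, S M ⊆ Finset.Ico 0 (ℓ M : ℤ)) (F : Finset ℤ) (x y : ℤ) :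
    defect ℓ S F (x + y) ≤ defect ℓ S F x + defect ℓ S F y := by
  refine dens_le_add (isBounded_defect hS F _) (isBounded_defect hS F _)
    (isBounded_defect hS F _) fun M => ?_
  set B := S M - F
  have h1 : B \ (B + {x + y}) ⊆ (B \ (B + {x})) ∪ ((B \ (B + {y})) + {x}) := by
    rw [sdiff_add_singleton, add_singleton_add_singleton, add_comm y x]
    intro z
    simp only [Finset.mem_sdiff, Finset.mem_union]
    tauto
  refine (Finset.card_le_card h1).trans ((Finset.card_union_le _ _).trans ?_)
  rw [Finset.card_add_singleton]

/-- Enlarging `F` by a translate increases the density of `S - F` by exactly the defect. This is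
what makes a nearly maximal density force a small defect. -/
theorem dens_union_translate (hS : ∀ M, S M ⊆ Finset.Ico 0 (ℓ M : ℤ)) (F : Finset ℤ) (j : ℤ) :
    dens ℓ (fun M => S M - (F ∪ (F + {j}))) = dens ℓ (fun M => S M - F) + defect ℓ S F j := by
  refine dens_eq_add (isBounded_sub hS F) (isBounded_defect hS F j) fun M => ?_
  set B := S M - F with hB
  have h1 : S M - (F ∪ (F + {j})) = (B + {-j}) ∪ B := by
    rw [Finset.sub_union, Finset.union_comm, ← sub_sub, ← hB, sub_eq_add_neg B,
      Finset.neg_singleton]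
  rw [h1, ← Finset.card_sdiff_add_card, add_comm, ← card_sdiff_add_neg_singleton,
    Finset.card_sdiff_comm (Finset.card_add_singleton _ _)]

theorem dens_translate (F : Finset ℤ) (t : ℤ) :
    dens ℓ (fun M => S M - (F + {t})) = dens ℓ (fun M => S M - F) :=
  dens_congr fun M => by
    rw [← sub_sub, sub_eq_add_neg (S M - F), Finset.neg_singleton, Finset.card_add_singleton]

theorem dens_sub_mono (hS : ∀ M, S M ⊆ Finset.Ico 0 (ℓ M : ℤ)) {F G : Finset ℤ} (h : F ⊆ G) :
    dens ℓ (fun M => S M - F) ≤ dens ℓ (fun M => S M - G) :=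
  dens_mono (isBounded_sub hS F) (isBounded_sub hS G) fun _ =>
    Finset.card_le_card (Finset.sub_subset_sub_left h)

/-- When passing from `F` to a larger set, the defect grows at most by the gain in density,
uniformly in the translation. -/
theorem defect_le_of_subset (hS : ∀ M, S M ⊆ Finset.Ico 0 (ℓ M : ℤ)) {F G : Finset ℤ} (h : F ⊆ G)
    (e : ℤ) : defect ℓ S G e ≤
      dens ℓ (fun M => S M - G) - dens ℓ (fun M => S M - F) + defect ℓ S F e := by
  have hsub : ∀ M, S M - F ⊆ S M - G := fun M => Finset.sub_subset_sub_left h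
  have hb : IsBounded ℓ fun M => (S M - G) \ (S M - F) :=
    (isBounded_sub hS G).of_card_le fun _ => Finset.card_le_card Finset.sdiff_subset
  have h1 : dens ℓ (fun M => S M - G) =
      dens ℓ (fun M => (S M - G) \ (S M - F)) + dens ℓ (fun M => S M - F) :=
    dens_eq_add hb (isBounded_sub hS F) fun M => by
      rw [Finset.card_sdiff_add_card_eq_card (hsub M)]
  rw [h1, add_sub_cancel_right]
  refine dens_le_add (isBounded_defect hS G e) hb (isBounded_defect hS F e) fun M => ?_
  refine (Finset.card_le_card ?_).trans (Finset.card_union_le _ _)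
  have h2 : S M - F + {e} ⊆ S M - G + {e} := Finset.add_subset_add_right (hsub M)
  intro z
  simp only [Finset.mem_sdiff, Finset.mem_union]
  have := @h2 z
  tauto

/-- A bound independent of `F`: the set `S M - F` lies in an interval that exceeds the length
`ℓ M` by a constant. -/
theorem dens_sub_le_two (hS : ∀ M, S M ⊆ Finset.Ico 0 (ℓ M : ℤ)) (hℓ : Tendsto ℓ atTop atTop)
    (F : Finset ℤ) : dens ℓ (fun M => S M - F) ≤ 2 := by
  obtain ⟨a, ha⟩ : ∃ a : ℕ, ∀ f ∈ F, |f| ≤ a := by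
    refine ⟨∑ f ∈ F, f.natAbs, fun f hf => ?_⟩
    rw [Int.abs_eq_natAbs]
    exact_mod_cast Finset.single_le_sum (f := fun f : ℤ => f.natAbs) (by simp) hf
  refine le_of_tendsto (isBounded_sub hS F).tendsto ?_
  have hev : ∀ᶠ M in atTop, 2 * a ≤ ℓ M := hℓ.eventually_ge_atTop _
  filter_upwards [(Nat.hyperfilter_le_atTop : _ ≤ atTop) hev] with M hM
  have h1 : S M - F ⊆ Finset.Ico (-a : ℤ) (ℓ M + a) := by
    intro z hz
    obtain ⟨p, hp, f, hf, rfl⟩ := Finset.mem_sub.1 hz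
    have h2 := Finset.mem_Ico.1 (hS M hp)
    have h3 := abs_le.1 (ha f hf)
    rw [Finset.mem_Ico]
    omega
  have h4 := Finset.card_le_card h1
  rw [Int.card_Ico] at h4
  refine div_le_of_le_mul₀ (by positivity) (by positivity) ?_
  have : (S M - F).card ≤ 2 * ℓ M := by omega
  exact_mod_cast this

theorem le_dens_sub (hS : ∀ M, S M ⊆ Finset.Ico 0 (ℓ M : ℤ)) (hℓ : Tendsto ℓ atTop atTop)
    {δ : ℝ} (hδ : ∀ᶠ M in atTop, δ * ℓ M ≤ (S M).card) {F : Finset ℤ} (hF : F.Nonempty) :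
    δ ≤ dens ℓ (fun M => S M - F) := by
  refine ge_of_tendsto (isBounded_sub hS F).tendsto ?_
  filter_upwards [(Nat.hyperfilter_le_atTop : _ ≤ atTop) hδ,
    (Nat.hyperfilter_le_atTop : _ ≤ atTop) (hℓ.eventually_ge_atTop 1)] with M hM h1
  rw [le_div_iff₀ (by exact_mod_cast h1)]
  refine hM.trans ?_
  exact_mod_cast Finset.card_le_card_sub_right hF

/-- The abstract form of the main argument. If every member `F` of a directed class `𝒜` of finite
sets stays in `𝒜` after adding its translates by a set `R` of integers which meets the
differences of every sequence and contains all large values of some polynomial `m ↦ m.choose k`,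
then some `S M - F` with `F ∈ 𝒜` meets its translate by `c`, for each given `c`. -/
theorem exists_not_disjoint_translate (hS : ∀ M, S M ⊆ Finset.Ico 0 (ℓ M : ℤ))
    (hℓ : Tendsto ℓ atTop atTop) {δ : ℝ} (hδ0 : 0 < δ)
    (hδ : ∀ᶠ M in atTop, δ * ℓ M ≤ (S M).card) {𝒜 : Set (Finset ℤ)}
    (hne : ∃ F ∈ 𝒜, F.Nonempty) (hdir : ∀ F ∈ 𝒜, ∀ G ∈ 𝒜, ∃ t, F ∪ (G + {t}) ∈ 𝒜)
    (hR : ∀ F ∈ 𝒜, ∃ R : Set ℤ, (∀ j ∈ R, F ∪ (F + {j}) ∈ 𝒜) ∧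
      (∀ s : ℕ → ℤ, ∃ a b, a < b ∧ s b - s a ∈ R) ∧ ∃ k n : ℕ, ∀ m ≥ n, (m.choose k : ℤ) ∈ R)
    (c : ℤ) : ∃ F ∈ 𝒜, ∃ M, ¬ Disjoint (S M - F) (S M - F + {c}) := by
  by_contra! hcon
  set β : Finset ℤ → ℝ := fun F => dens ℓ (fun M => S M - F) with hβ
  set s := sSup (β '' 𝒜) with hs
  have hbdd : BddAbove (β '' 𝒜) :=
    ⟨2, by rintro _ ⟨F, -, rfl⟩; exact dens_sub_le_two hS hℓ F⟩
  have hβs : ∀ F ∈ 𝒜, β F ≤ s := fun F hF => le_csSup hbdd ⟨F, hF, rfl⟩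
  obtain ⟨F₀, hF₀, hF₀ne⟩ := hne
  have hstep : ∀ (i : ℕ) (F : 𝒜), ∃ G : 𝒜, F.1 ⊆ G.1 ∧ s - 1 / (i + 1) ≤ β G.1 := by
    rintro i ⟨F, hF⟩
    have hlt : s - 1 / (i + 1) < s := by
      have : (0 : ℝ) < 1 / (i + 1) := by positivity
      linarith
    obtain ⟨_, ⟨G, hG, rfl⟩, hlt⟩ := exists_lt_of_lt_csSup (Set.Nonempty.image β ⟨F, hF⟩) hlt
    obtain ⟨t, ht⟩ := hdir F hF G hG
    refine ⟨⟨_, ht⟩, Finset.subset_union_left, hlt.le.trans ?_⟩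
    calc β G = β (G + {t}) := (dens_translate G t).symm
      _ ≤ _ := dens_sub_mono hS Finset.subset_union_right
  choose f hfsub hfβ using hstep
  set Φ : ℕ → 𝒜 := fun i => Nat.rec ⟨F₀, hF₀⟩ (fun i F => f i F) i with hΦ
  have hΦs : ∀ i, Φ (i + 1) = f i (Φ i) := fun i => rfl
  have hmono : Monotone fun i => (Φ i).1 :=
    monotone_nat_of_le_succ fun i => by rw [hΦs]; exact hfsub i _
  have hΦβ : ∀ i, s - 1 / (i + 1) ≤ β (Φ (i + 1)).1 := fun i => by rw [hΦs]; exact hfβ i _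
  have hΦne : ∀ i, (Φ i).1.Nonempty := fun i => hF₀ne.mono (hmono (Nat.zero_le i))
  -- The sequence `Φ` increases and its densities tend to the supremum `s`; the limit of the defects
  -- is the pseudonorm to which the recurrence theorem applies.
  set N : ℤ → ℝ := fun e => ultraLim fun i => defect ℓ S (Φ i).1 e with hN
  have hlim : ∀ e, Tendsto (fun i => defect ℓ S (Φ i).1 e) (hyperfilter ℕ : Filter ℕ)
      (𝓝 (N e)) := fun e => by
    refine tendsto_ultraLim (C := 2) fun i => ⟨defect_nonneg hS _ _, ?_⟩
    refine le_trans ?_ (dens_sub_le_two hS hℓ (Φ i).1)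
    exact dens_mono (isBounded_defect hS _ _) (isBounded_sub hS _) fun _ =>
      Finset.card_le_card Finset.sdiff_subset
  have h0 : N 0 = 0 := tendsto_nhds_unique (hlim 0) 
    (by simp only [defect_zero]; exact tendsto_const_nhds)
  have hneg : ∀ x, N (-x) = N x := fun x => by simp only [hN, defect_neg]
  have hadd : ∀ x y, N (x + y) ≤ N x + N y := fun x y =>
    le_of_tendsto_of_tendsto' (hlim _) ((hlim x).add (hlim y)) fun i => defect_add_le hS _ x y
  have hsmall : ∀ η > 0, ∃ F ∈ 𝒜, ∀ j, F ∪ (F + {j}) ∈ 𝒜 → N j ≤ η := by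
    intro η hη
    obtain ⟨i, hi⟩ := exists_nat_one_div_lt (half_pos hη)
    refine ⟨_, (Φ (i + 1)).2, fun j hj => ?_⟩
    refine le_of_tendsto (hlim j) ?_
    filter_upwards [(Nat.hyperfilter_le_atTop : _ ≤ atTop) (eventually_ge_atTop (i + 1))] with l hl
    have h1 := defect_le_of_subset hS (hmono hl) j
    have h2 : β ((Φ (i + 1)).1 ∪ ((Φ (i + 1)).1 + {j})) =
      β (Φ (i + 1)).1 + defect ℓ S (Φ (i + 1)).1 j := dens_union_translate hS _ j
    have h3 := hβs _ hj
    have h4 := hβs _ (Φ l).2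
    have h5 := hΦβ i
    simp only [hβ] at h2 h3 h4 h5 h1
    linarith
  have htb : ∀ η > 0, ∀ s : ℕ → ℤ, ∃ a b, a < b ∧ N (s b - s a) ≤ η := by
    intro η hη u
    obtain ⟨F, hF, h⟩ := hsmall η hη
    obtain ⟨R, hR1, hR2, -⟩ := hR F hF
    obtain ⟨a, b, hab, hmem⟩ := hR2 u
    exact ⟨a, b, hab, h _ (hR1 _ hmem)⟩
  have h1 : N 1 ≤ 0 := by
    refine le_of_forall_pos_le_add fun η hη => ?_
    obtain ⟨F, hF, h⟩ := hsmall η hη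
    obtain ⟨R, hR1, -, k, n, hk⟩ := hR F hF
    rw [zero_add]
    exact norm_one_le_of_choose h0 hneg hadd htb fun m hm => h _ (hR1 _ (hk m hm))
  have hc0 : N c ≤ 0 := by
    have habs : N c = N (c.natAbs : ℤ) := by
      rcases Int.natAbs_eq c with h | h
      · exact congrArg N h
      · rw [← hneg]; congr 1; omega
    have h2 := norm_natCast_mul_le_of_subadditive h0 hadd c.natAbs 1
    rw [mul_one, ← habs] at h2
    refine h2.trans (mul_nonpos_of_nonneg_of_nonpos (by positivity) h1)
  have hcδ : δ ≤ N c := by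
    refine ge_of_tendsto' (hlim c) fun i => ?_
    refine (le_dens_sub hS hℓ hδ (hΦne i)).trans (le_of_eq (dens_congr fun M => ?_))
    rw [Finset.sdiff_eq_self_of_disjoint (hcon _ (Φ i).2 M)]
  linarith

end FinsetDensity

/-! ### Dense orbits -/

/-- Topological transitivity in terms of open sets yields a point with a dense orbit, by Baire's
theorem. -/
theorem exists_dense_zpow_orbit {X : Type*} [TopologicalSpace X] [CompactSpace X]
    [TopologicalSpace.MetrizableSpace X] [Nonempty X] (T : X ≃ₜ X)
    (h : ∀ U V : Set X, IsOpen U → U.Nonempty → IsOpen V → V.Nonempty →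
      ∃ n : ℤ, ∃ x ∈ U, (T ^ n) x ∈ V) : IsTopologicallyErgodic T := by
  let := TopologicalSpace.metrizableSpaceMetric X
  have hd : Dense (⋂ V ∈ TopologicalSpace.countableBasis X, ⋃ n : ℤ, (T ^ n : X ≃ₜ X) ⁻¹' V) := by
    refine dense_biInter_of_isOpen (fun V hV => isOpen_iUnion fun n => ?_)
      (TopologicalSpace.countable_countableBasis X) fun V hV => ?_
    · exact (TopologicalSpace.isOpen_of_mem_countableBasis hV).preimage (T ^ n : X ≃ₜ X).continuous
    · rw [dense_iff_inter_open]
      intro U hU hUne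
      obtain ⟨n, x, hx, hx'⟩ := h U V hU hUne (TopologicalSpace.isOpen_of_mem_countableBasis hV)
        (TopologicalSpace.nonempty_of_mem_countableBasis hV)
      exact ⟨x, hx, Set.mem_iUnion.2 ⟨n, hx'⟩⟩
  obtain ⟨x, hx⟩ := hd.nonempty
  refine ⟨x, (TopologicalSpace.isBasis_countableBasis X).dense_iff.2 fun V hV _ => ?_⟩
  obtain ⟨n, hn⟩ := Set.mem_iUnion.1 (Set.mem_iInter₂.1 hx V hV)
  exact ⟨_, hn, n, rfl⟩

theorem prodCongr_pow {X : Type*} [TopologicalSpace X] (T : X ≃ₜ X) (n : ℕ) :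
    (T.prodCongr T) ^ n = (T ^ n).prodCongr (T ^ n) := by
  induction n with
  | zero => rfl
  | succ n ih => rw [pow_succ, pow_succ, ih]; rfl

theorem prodCongr_zpow_apply {X : Type*} [TopologicalSpace X] (T : X ≃ₜ X) (n : ℤ) (x y : X) :
    ((T.prodCongr T) ^ n) (x, y) = ((T ^ n) x, (T ^ n) y) := by
  cases n with
  | ofNat n => simp only [Int.ofNat_eq_natCast, zpow_natCast, prodCongr_pow]; rfl
  | negSucc n => simp only [zpow_negSucc, prodCongr_pow]; rfl

/-! ### Occurrences and gaps of basic words -/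

namespace PascalSubshift

/-- The word `w` occurs in the word `z` starting at position `p`, counted from `0`. -/
def OccursAt (w z : List PascalLetter) (p : ℕ) : Prop := ∃ s t, z = s ++ w ++ t ∧ s.length = p

theorem OccursAt.trans {w y z : List PascalLetter} {p q : ℕ} (h : OccursAt w y p)
    (h' : OccursAt y z q) : OccursAt w z (q + p) := by
  obtain ⟨s, t, rfl, rfl⟩ := h
  obtain ⟨s', t', rfl, rfl⟩ := h'
  exact ⟨s' ++ s, t ++ t', by simp, by simp⟩

theorem occursAt_self (w : List PascalLetter) : OccursAt w w 0 := ⟨[], [], by simp, rfl⟩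

theorem occursAt_append_left (u v : List PascalLetter) : OccursAt u (u ++ v) 0 :=
  ⟨[], v, by simp, rfl⟩

theorem occursAt_append_right (u v : List PascalLetter) : OccursAt v (u ++ v) u.length :=
  ⟨u, [], by simp, rfl⟩

theorem OccursAt.lt_length {w z : List PascalLetter} {p : ℕ} (h : OccursAt w z p) (hw : w ≠ []) :
    p < z.length := by
  obtain ⟨s, t, rfl, rfl⟩ := h
  have := List.length_pos_iff.2 hw
  simp
  omega

theorem zeta_succ_succ {i j : ℕ} (h : j ≠ i) :
    zeta (i + 1) (j + 1) = zeta i (j + 1) ++ zeta i j := by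
  rw [zeta, if_neg h]

theorem zeta_succ_zero (i : ℕ) : zeta (i + 1) 0 = [PascalLetter.a] := by rw [zeta]

theorem zeta_succ_self (i : ℕ) : zeta (i + 1) (i + 1) = [PascalLetter.b] := by
  rw [zeta, if_pos rfl]

/-- For `j > i + 1` both sides vanish. -/
theorem length_zeta (i j : ℕ) : (zeta (i + 1) j).length = (i + 1).choose j := by
  induction i generalizing j with
  | zero =>
    rcases j with _ | _ | j
    · simp [zeta]
    · simp [zeta]
    · rw [Nat.choose_eq_zero_of_lt (by omega)]
      simp [zeta]
  | succ i ih =>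
    rcases j with _ | j
    · simp [zeta]
    · by_cases h : j = i + 1
      · subst h
        simp [zeta_succ_self]
      · rw [zeta_succ_succ h, List.length_append, ih, ih, Nat.choose_succ_succ (i + 1), add_comm]

theorem length_zeta_of_pos {i : ℕ} (hi : 1 ≤ i) (j : ℕ) : (zeta i j).length = i.choose j := by
  obtain ⟨i, rfl⟩ : ∃ l, i = l + 1 := ⟨i - 1, by omega⟩
  exact length_zeta i j

theorem zeta_ne_nil {i j : ℕ} (hi : 1 ≤ i) (hj : j ≤ i) : zeta i j ≠ [] := by
  rw [← List.length_pos_iff, length_zeta_of_pos hi]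
  exact Nat.choose_pos hj

theorem occursAt_zeta_succ_left {n k : ℕ} (hn : 1 ≤ n) (hk : k ≤ n) :
    OccursAt (zeta n k) (zeta (n + 1) k) 0 := by
  rcases k with _ | k
  · obtain ⟨n, rfl⟩ : ∃ l, n = l + 1 := ⟨n - 1, by omega⟩
    rw [zeta_succ_zero, zeta_succ_zero]
    exact occursAt_self _
  · rw [zeta_succ_succ (by omega)]
    exact occursAt_append_left _ _

theorem exists_occursAt_zeta_succ_right {n k : ℕ} (hn : 1 ≤ n) (hk : k ≤ n) :
    ∃ p, OccursAt (zeta n k) (zeta (n + 1) (k + 1)) p := by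
  rcases hk.lt_or_eq with h | rfl
  · rw [zeta_succ_succ h.ne]
    exact ⟨_, occursAt_append_right _ _⟩
  · obtain ⟨n, rfl⟩ : ∃ l, k = l + 1 := ⟨k - 1, by omega⟩
    rw [zeta_succ_self, zeta_succ_self]
    exact ⟨0, occursAt_self _⟩

theorem occursAt_zeta_add_left {n k : ℕ} (hn : 1 ≤ n) (hk : k ≤ n) (i : ℕ) :
    OccursAt (zeta n k) (zeta (n + i) k) 0 := by
  induction i with
  | zero => exact occursAt_self _
  | succ i ih => exact ih.trans (occursAt_zeta_succ_left (by omega) (by omega))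

theorem exists_occursAt_zeta_add {n k : ℕ} (hn : 1 ≤ n) (hk : k ≤ n) {i l : ℕ} (hl : l ≤ i) :
    ∃ p, OccursAt (zeta n k) (zeta (n + i) (k + l)) p := by
  obtain ⟨i, rfl⟩ : ∃ m, i = m + l := ⟨i - l, by omega⟩
  induction l with
  | zero => exact ⟨0, occursAt_zeta_add_left hn hk i⟩
  | succ l ih =>
    obtain ⟨p, hp⟩ := ih (by omega)
    obtain ⟨q, hq⟩ := exists_occursAt_zeta_succ_right (n := n + (i + l)) (k := k + l)
      (by omega) (by omega)
    exact ⟨_, hp.trans hq⟩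

theorem mem_language_of_occursAt {w : List PascalLetter} {n k p : ℕ} (hn : 1 ≤ n) (hk : k ≤ n)
    (h : OccursAt w (zeta n k) p) : w ∈ language := by
  obtain ⟨s, t, h, -⟩ := h
  exact ⟨n, k, hn, hk, s, t, h.symm⟩

theorem zeta_mem_language {n k : ℕ} (hn : 1 ≤ n) (hk : k ≤ n) : zeta n k ∈ language :=
  mem_language_of_occursAt hn hk (occursAt_self _)

theorem mem_language_of_infix {u v : List PascalLetter} (hv : v ∈ language) (h : u <:+: v) :
    u ∈ language := by
  obtain ⟨i, j, hi, hj, h'⟩ := hv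
  exact ⟨i, j, hi, hj, h.trans h'⟩

/-- Passing to the basic word two levels up makes the indices interior, where `zeta` splits. -/
theorem exists_occursAt_zeta {w : List PascalLetter} (hw : w ∈ language) :
    ∃ n k p, 0 < k ∧ k < n ∧ OccursAt w (zeta n k) p := by
  obtain ⟨i, j, hi, hj, s, t, h⟩ := hw
  obtain ⟨q, hq⟩ := exists_occursAt_zeta_add hi hj (i := 2) (l := 1) (by omega)
  exact ⟨i + 2, j + 1, _, by omega, by omega, OccursAt.trans ⟨s, t, h.symm, rfl⟩ hq⟩

theorem exists_occursAt_common {n k n' k' : ℕ} (hk : 0 < k) (hkn : k < n) (hk' : 0 < k')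
    (hkn' : k' < n') : ∃ p q, OccursAt (zeta n k) (zeta (n + n') (k + k')) p ∧
      OccursAt (zeta n' k') (zeta (n + n') (k + k')) q := by
  obtain ⟨p, hp⟩ := exists_occursAt_zeta_add (by omega) hkn.le hkn'.le
  obtain ⟨q, hq⟩ := exists_occursAt_zeta_add (by omega) hkn'.le hkn.le
  refine ⟨p, q, hp, ?_⟩
  rwa [add_comm n' n, add_comm k' k] at hq

/-- The differences between the positions of two occurrences of `w` in one word of the language. -/
def gaps (w : List PascalLetter) : Set ℤ :=
  {d | ∃ z ∈ language, ∃ p q : ℕ, OccursAt w z p ∧ OccursAt w z q ∧ d = q - p}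

/-- In `zeta (m + 2) (k + 1) = zeta m (k + 1) ++ zeta m k ++ zeta (m + 1) k` the last two factors
both start with `zeta n k`, and the first of them has length `m.choose k`. -/
theorem choose_mem_gaps {n k m : ℕ} (hkn : k < n) (hm : n ≤ m) :
    (m.choose k : ℤ) ∈ gaps (zeta n k) := by
  have e1 : zeta (m + 2) (k + 1) = zeta m (k + 1) ++ (zeta m k ++ zeta (m + 1) k) := by
    rw [zeta_succ_succ (by omega), zeta_succ_succ (by omega), List.append_assoc]
  obtain ⟨i, rfl⟩ := Nat.exists_eq_add_of_le hm
  have h1 := occursAt_zeta_add_left (by omega) hkn.le i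
  have h2 := occursAt_zeta_add_left (by omega) hkn.le (i + 1)
  refine ⟨zeta (n + i + 2) (k + 1), zeta_mem_language (by omega) (by omega),
    (zeta (n + i) (k + 1)).length, (zeta (n + i) (k + 1)).length + (zeta (n + i) k).length,
    ?_, ?_, ?_⟩
  · rw [e1]
    exact (h1.trans (occursAt_append_left _ _)).trans (occursAt_append_right _ _)
  · rw [e1]
    exact (h2.trans (occursAt_append_right _ _)).trans (occursAt_append_right _ _)
  · rw [length_zeta_of_pos (by omega) k]
    push_cast
    ring

open Classical in
/-- The positions of the occurrences of `w` in `z`, as integers. The range of positions excludes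
`z.length`, so this is all of them only for nonempty `w`. -/
noncomputable def occ (w z : List PascalLetter) : Finset ℤ :=
  ((Finset.range z.length).filter (OccursAt w z)).image (↑)

theorem mem_occ {w z : List PascalLetter} (hw : w ≠ []) {x : ℤ} :
    x ∈ occ w z ↔ ∃ p : ℕ, OccursAt w z p ∧ (p : ℤ) = x := by
  simp only [occ, Finset.mem_image, Finset.mem_filter, Finset.mem_range]
  exact ⟨fun ⟨p, ⟨_, h⟩, e⟩ => ⟨p, h, e⟩, fun ⟨p, h, e⟩ => ⟨p, ⟨h.lt_length hw, h⟩, e⟩⟩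

theorem occ_subset (w z : List PascalLetter) : occ w z ⊆ Finset.Ico 0 (z.length : ℤ) := by
  intro x hx
  simp only [occ, Finset.mem_image, Finset.mem_filter, Finset.mem_range] at hx
  obtain ⟨p, ⟨h, -⟩, rfl⟩ := hx
  rw [Finset.mem_Ico]
  omega

theorem card_occ_append {w : List PascalLetter} (hw : w ≠ []) (u v : List PascalLetter) :
    (occ w u).card + (occ w v).card ≤ (occ w (u ++ v)).card := by
  have hd : Disjoint (occ w u) (occ w v + {(u.length : ℤ)}) := by
    rw [Finset.disjoint_left]
    intro x hx hx'
    have h1 := Finset.mem_Ico.1 (occ_subset _ _ hx)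
    obtain ⟨y, hy, z, hz, rfl⟩ := Finset.mem_add.1 hx'
    have h2 := Finset.mem_Ico.1 (occ_subset _ _ hy)
    rw [Finset.mem_singleton] at hz
    omega
  rw [← Finset.card_add_singleton (occ w v) (u.length : ℤ), ← Finset.card_union_of_disjoint hd]
  refine Finset.card_le_card (Finset.union_subset ?_ ?_)
  · intro x hx
    obtain ⟨p, hp, rfl⟩ := (mem_occ hw).1 hx
    exact (mem_occ hw).2 ⟨p, by simpa using hp.trans (occursAt_append_left u v), rfl⟩
  · intro x hx
    obtain ⟨y, hy, z, hz, rfl⟩ := Finset.mem_add.1 hx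
    rw [Finset.mem_singleton] at hz
    obtain ⟨p, hp, rfl⟩ := (mem_occ hw).1 hy
    refine (mem_occ hw).2 ⟨_, hp.trans (occursAt_append_right u v), ?_⟩
    rw [hz]
    push_cast
    ring

/-- The occurrences of `zeta n k` in `zeta (n + i) (k + l)` satisfy at least Pascal's recursion. -/
theorem choose_le_card_occ {n k : ℕ} (hn : 1 ≤ n) (hk : k ≤ n) (i l : ℕ) (hl : l ≤ i) :
    i.choose l ≤ (occ (zeta n k) (zeta (n + i) (k + l))).card := by
  have hw := zeta_ne_nil hn hk
  have hpos : ∀ i l, l ≤ i → 1 ≤ (occ (zeta n k) (zeta (n + i) (k + l))).card := by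
    intro i l hl
    obtain ⟨p, hp⟩ := exists_occursAt_zeta_add hn hk hl
    exact Finset.card_pos.2 ⟨p, (mem_occ hw).2 ⟨p, hp, rfl⟩⟩
  induction i generalizing l with
  | zero =>
    obtain rfl : l = 0 := by omega
    simpa using hpos 0 0 le_rfl
  | succ i ih =>
    rcases l with _ | l
    · simpa using hpos (i + 1) 0 (by omega)
    · rcases (show l ≤ i by omega).lt_or_eq with h | rfl
      · rw [← add_assoc n, ← add_assoc k, zeta_succ_succ (by omega), Nat.choose_succ_succ, add_comm]
        exact (add_le_add (ih (l + 1) (by omega)) (ih l h.le)).trans (card_occ_append hw _ _)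
      · simpa using hpos (l + 1) (l + 1) le_rfl

theorem choose_succ_succ_le_four_mul {N K : ℕ} (h : N + 1 ≤ 4 * (K + 1)) :
    (N + 1).choose (K + 1) ≤ 4 * N.choose K := by
  have h1 := Nat.add_one_mul_choose_eq N K
  refine Nat.le_of_mul_le_mul_right ?_ (Nat.succ_pos K)
  calc (N + 1).choose (K + 1) * (K + 1) = (N + 1) * N.choose K := h1.symm
    _ ≤ 4 * (K + 1) * N.choose K := by gcongr
    _ = 4 * N.choose K * (K + 1) := by ring

theorem choose_succ_le_four_mul {N K : ℕ} (hK : K ≤ N) (h : N + 1 ≤ 4 * (N + 1 - K)) :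
    (N + 1).choose K ≤ 4 * N.choose K := by
  have h1 := Nat.choose_mul_succ_eq N K
  refine Nat.le_of_mul_le_mul_right (c := N + 1 - K) ?_ (by omega)
  calc (N + 1).choose K * (N + 1 - K) = N.choose K * (N + 1) := h1.symm
    _ ≤ N.choose K * (4 * (N + 1 - K)) := by gcongr
    _ = _ := by ring

/-- Going from the centre of row `2 * M` down to row `2 * M - a - b` costs at most a factor of
`4` per row as long as `M` is large compared with `a + b`. -/
theorem central_choose_le {M : ℕ} (a b : ℕ) (h : 2 * (a + b) ≤ M) :
    (2 * M).choose M ≤ 4 ^ (a + b) * (2 * M - a - b).choose (M - a) := by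
  induction b with
  | zero =>
    induction a with
    | zero => simp
    | succ a ih =>
      refine (ih (by omega)).trans ?_
      have := choose_succ_succ_le_four_mul (N := 2 * M - (a + 1)) (K := M - (a + 1)) (by omega)
      rw [show 2 * M - (a + 1) + 1 = 2 * M - a - 0 by omega,
        show M - (a + 1) + 1 = M - a by omega] at this
      calc _ ≤ 4 ^ (a + 0) * (4 * (2 * M - (a + 1)).choose (M - (a + 1))) := by gcongr
        _ = _ := by simp only [add_zero, Nat.sub_zero, pow_succ]; ring
  | succ b ih =>
    refine (ih (by omega)).trans ?_
    have := choose_succ_le_four_mul (N := 2 * M - a - (b + 1)) (K := M - a) (by omega) (by omega)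
    rw [show 2 * M - a - (b + 1) + 1 = 2 * M - a - b by omega] at this
    calc _ ≤ 4 ^ (a + b) * (4 * (2 * M - a - (b + 1)).choose (M - a)) := by gcongr
      _ = _ := by rw [← add_assoc, pow_succ]; ring

/-- Each basic word occurs with positive density in the central basic words. -/
theorem eventually_le_card_occ {n k : ℕ} (hn : 1 ≤ n) (hk : k ≤ n) :
    ∀ᶠ M in atTop, (1 / 4 ^ n : ℝ) * ((zeta (2 * M) M).length : ℕ) ≤
      (occ (zeta n k) (zeta (2 * M) M)).card := by
  filter_upwards [eventually_ge_atTop (2 * n)] with M hM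
  have h1 := central_choose_le (M := M) k (n - k) (by omega)
  have h2 := choose_le_card_occ hn hk (2 * M - k - (n - k)) (M - k) (by omega)
  rw [show n + (2 * M - k - (n - k)) = 2 * M by omega, show k + (M - k) = M by omega] at h2
  rw [show k + (n - k) = n by omega] at h1
  rw [length_zeta_of_pos (by omega), one_div, inv_mul_le_iff₀ (by positivity)]
  exact_mod_cast h1.trans (Nat.mul_le_mul_left _ h2)

theorem tendsto_length_zeta : Tendsto (fun M => (zeta (2 * M) M).length) atTop atTop := by
  refine tendsto_atTop_mono' _ ?_ tendsto_id
  filter_upwards [eventually_ge_atTop 1] with M hM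
  rw [length_zeta_of_pos (by omega)]
  have := Nat.choose_le_centralBinom 1 M
  rw [Nat.choose_one_right, Nat.centralBinom_eq_two_mul_choose] at this
  simp only [id]
  omega

theorem sub_mem_gaps {w : List PascalLetter} (hw : w ≠ []) {n k : ℕ} (hk : k ≤ n) {p q : ℤ}
    (hp : p ∈ occ w (zeta n k)) (hq : q ∈ occ w (zeta n k)) : q - p ∈ gaps w := by
  obtain ⟨p, hp', rfl⟩ := (mem_occ hw).1 hp
  obtain ⟨q, hq', rfl⟩ := (mem_occ hw).1 hq
  refine ⟨_, zeta_mem_language ?_ hk, p, q, hp', hq', rfl⟩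
  rcases n with _ | n
  · exact absurd (hp'.lt_length hw) (by simp [zeta])
  · omega

/-- Pigeonhole principle: the translates of the set of occurrences by the terms of the sequence
cannot be pairwise disjoint, since that set has positive density. -/
theorem exists_sub_mem_gaps {n k : ℕ} (hn : 1 ≤ n) (hk : k ≤ n) (s : ℕ → ℤ) :
    ∃ a b, a < b ∧ s b - s a ∈ gaps (zeta n k) := by
  have hw := zeta_ne_nil hn hk
  -- The density is at least `1 / 4 ^ n`, and the translates fit into an interval of length at most
  -- `2 * ℓ`, so `3 * 4 ^ n` of them are too many.
  obtain ⟨r, hr⟩ : ∃ r : ℕ, r = 3 * 4 ^ n := ⟨_, rfl⟩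
  set A : ℕ := ∑ a ∈ Finset.range r, (s a).natAbs with hA
  have hsA : ∀ a < r, (s a).natAbs ≤ A := fun a ha =>
    Finset.single_le_sum (f := fun a => (s a).natAbs) (by simp) (Finset.mem_range.2 ha)
  obtain ⟨M, hM, hMA⟩ := ((eventually_le_card_occ hn hk).and
    (tendsto_length_zeta.eventually_ge_atTop (2 * A + 1))).exists
  set S := occ (zeta n k) (zeta (2 * M) M) with hS
  set ℓ := (zeta (2 * M) M).length with hℓ
  by_contra! hcon
  have hdisj : ∀ a ∈ Finset.range r, ∀ b ∈ Finset.range r, a ≠ b →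
      Disjoint (S + {s a}) (S + {s b}) := by
    have hlt : ∀ a b, a < b → Disjoint (S + {s a}) (S + {s b}) := by
      intro a b hab
      rw [Finset.disjoint_left]
      intro x hx hx'
      obtain ⟨p, hp, _, h1, rfl⟩ := Finset.mem_add.1 hx
      obtain ⟨q, hq, _, h2, h3⟩ := Finset.mem_add.1 hx'
      rw [Finset.mem_singleton] at h1 h2
      subst h1 h2
      refine hcon a b hab ?_
      rw [show s b - s a = p - q by omega]
      exact sub_mem_gaps hw (by omega) hq hp
    intro a _ b _ hab
    rcases hab.lt_or_gt with h | h
    · exact hlt a b h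
    · exact (hlt b a h).symm
  have hsub : (Finset.range r).biUnion (fun a => S + {s a}) ⊆ Finset.Ico (-A : ℤ) (ℓ + A) := by
    intro x hx
    obtain ⟨a, ha, hx⟩ := Finset.mem_biUnion.1 hx
    obtain ⟨p, hp, _, h1, rfl⟩ := Finset.mem_add.1 hx
    rw [Finset.mem_singleton] at h1
    have h2 := Finset.mem_Ico.1 (occ_subset _ _ hp)
    have h3 := hsA a (Finset.mem_range.1 ha)
    rw [Finset.mem_Ico]
    omega
  have hcard := Finset.card_le_card hsub
  rw [Finset.card_biUnion hdisj, Int.card_Ico] at hcard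
  simp only [Finset.card_add_singleton, Finset.sum_const, Finset.card_range, smul_eq_mul] at hcard
  have h4 : ℓ ≤ 4 ^ n * S.card := by
    rw [one_div, inv_mul_le_iff₀ (by positivity)] at hM
    exact_mod_cast hM
  have h5 : r * S.card = 3 * (4 ^ n * S.card) := by rw [hr]; ring
  omega

/-- The finite sets of integers which, up to translation, consist of positions of occurrences of
`w` in one word of the language. Other occurrences are allowed. -/
def Admissible (w : List PascalLetter) : Set (Finset ℤ) :=
  {F | ∃ z ∈ language, ∃ t : ℤ, ∀ f ∈ F, ∃ p : ℕ, OccursAt w z p ∧ (p : ℤ) = f + t}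

theorem exists_union_translate_mem_admissible {w : List PascalLetter} {F G : Finset ℤ}
    (hF : F ∈ Admissible w) (hG : G ∈ Admissible w) : ∃ t, F ∪ (G + {t}) ∈ Admissible w := by
  obtain ⟨z, hz, t, h⟩ := hF
  obtain ⟨z', hz', t', h'⟩ := hG
  obtain ⟨n, k, p, hk, hkn, hp⟩ := exists_occursAt_zeta hz
  obtain ⟨n', k', p', hk', hkn', hp'⟩ := exists_occursAt_zeta hz'
  obtain ⟨q, q', hq, hq'⟩ := exists_occursAt_common hk hkn hk' hkn'
  refine ⟨t' + q' + p' - (t + q + p), zeta (n + n') (k + k'),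
    zeta_mem_language (by omega) (by omega), t + q + p, fun f hf => ?_⟩
  rcases Finset.mem_union.1 hf with hf | hf
  · obtain ⟨o, ho, e⟩ := h f hf
    exact ⟨_, (ho.trans hp).trans hq, by push_cast; omega⟩
  · obtain ⟨g, hg, _, h1, rfl⟩ := Finset.mem_add.1 hf
    rw [Finset.mem_singleton] at h1
    obtain ⟨o, ho, e⟩ := h' g hg
    exact ⟨_, (ho.trans hp').trans hq', by push_cast; omega⟩

theorem exists_zeta_gaps_admissible {w : List PascalLetter} {F : Finset ℤ}
    (hF : F ∈ Admissible w) : ∃ n k, 0 < k ∧ k < n ∧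
      ∀ j ∈ gaps (zeta n k), F ∪ (F + {j}) ∈ Admissible w := by
  obtain ⟨z, hz, t, h⟩ := hF
  obtain ⟨n, k, p, hk, hkn, hp⟩ := exists_occursAt_zeta hz
  refine ⟨n, k, hk, hkn, ?_⟩
  rintro j ⟨z', hz', q, q', hq, hq', rfl⟩
  refine ⟨z', hz', t + p + q, fun f hf => ?_⟩
  rcases Finset.mem_union.1 hf with hf | hf
  · obtain ⟨o, ho, e⟩ := h f hf
    exact ⟨_, (ho.trans hp).trans hq, by push_cast; omega⟩
  · obtain ⟨g, hg, _, h1, rfl⟩ := Finset.mem_add.1 hf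
    rw [Finset.mem_singleton] at h1
    obtain ⟨o, ho, e⟩ := h g hg
    exact ⟨_, (ho.trans hp).trans hq', by push_cast; omega⟩

/-- The arithmetic core of weak mixing: every integer is a difference of two gaps. -/
theorem exists_add_mem_gaps {n k : ℕ} (hk : 0 < k) (hkn : k < n) (c : ℤ) :
    ∃ d ∈ gaps (zeta n k), d + c ∈ gaps (zeta n k) := by
  have hn : 1 ≤ n := by omega
  have hw := zeta_ne_nil hn hkn.le
  obtain ⟨F, ⟨z, hz, t, hF⟩, M, hM⟩ := FinsetDensity.exists_not_disjoint_translate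
    (S := fun M => occ (zeta n k) (zeta (2 * M) M)) (fun M => occ_subset _ _)
    tendsto_length_zeta (by positivity) (eventually_le_card_occ hn hkn.le)
    (𝒜 := Admissible (zeta n k))
    ⟨{0}, ⟨zeta n k, zeta_mem_language hn hkn.le, 0, fun f hf => ⟨0, occursAt_self _, by
      simpa using (Finset.mem_singleton.1 hf).symm⟩⟩, by simp⟩
    (fun F hF G hG => exists_union_translate_mem_admissible hF hG)
    (fun F hF => by
      obtain ⟨n', k', hk', hkn', h⟩ := exists_zeta_gaps_admissible hF
      exact ⟨_, h, exists_sub_mem_gaps (by omega) hkn'.le, k', n',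
        fun m hm => choose_mem_gaps hkn' hm⟩) c
  obtain ⟨x, hx, hx'⟩ := Finset.not_disjoint_iff.1 hM
  obtain ⟨p, hp, f, hf, rfl⟩ := Finset.mem_sub.1 hx
  obtain ⟨y, hy, c', hc', e⟩ := Finset.mem_add.1 hx'
  obtain ⟨q, hq, g, hg, rfl⟩ := Finset.mem_sub.1 hy
  rw [Finset.mem_singleton] at hc'
  obtain ⟨o, ho, eo⟩ := hF f hf
  obtain ⟨o', ho', eo'⟩ := hF g hg
  -- The common point `p - f = q - g + c` gives `p - q = (f - g) + c`, where `p - q` is a gap in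
  -- `zeta (2 * M) M` and `f - g` is a gap in the word witnessing the admissibility of `F`.
  refine ⟨f - g, ⟨z, hz, o', o, ho', ho, by omega⟩, ?_⟩
  rw [show f - g + c = p - q by omega]
  exact sub_mem_gaps hw (by omega) hq hp

/-! ### Points of the subshift and weak mixing -/

theorem shift_zpow_apply (n : ℤ) (x : sequences) (m : ℤ) : ((shift ^ n) x).1 m = x.1 (m + n) := by
  induction n generalizing x m with
  | zero => simp
  | succ n ih =>
    rw [zpow_add_one]
    change ((shift ^ (n : ℤ)) (shift x)).1 m = _
    rw [ih]
    change x.1 (m + n + 1) = _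
    rw [add_assoc]
  | pred n ih =>
    rw [zpow_sub_one]
    change ((shift ^ (-n : ℤ)) (shift.symm x)).1 m = _
    rw [ih]
    change x.1 (m + -n - 1) = _
    rw [add_sub_assoc]

theorem exists_cons_append_mem_language {z : List PascalLetter} (hz : z ∈ language) :
    ∃ α β, α :: (z ++ [β]) ∈ language := by
  obtain ⟨n, k, p, hk, hkn, s, t, e, -⟩ := exists_occursAt_zeta hz
  have hL : zeta (n + 2) (k + 1) ∈ language := zeta_mem_language (by omega) (by omega)
  rw [zeta_succ_succ (by omega), zeta_succ_succ (by omega), e] at hL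
  obtain ⟨s', α, hα⟩ := List.eq_nil_or_concat' (zeta n (k + 1) ++ s) |>.resolve_left (by
    simp [zeta_ne_nil (show 1 ≤ n by omega) (show k + 1 ≤ n by omega)])
  obtain ⟨β, t', hβ⟩ := List.exists_cons_of_ne_nil (l := t ++ zeta (n + 1) k) (by
    simp [zeta_ne_nil (show 1 ≤ n + 1 by omega) (show k ≤ n + 1 by omega)])
  refine ⟨α, β, mem_language_of_infix hL ⟨s', t', ?_⟩⟩
  calc s' ++ α :: (z ++ [β]) ++ t' = (s' ++ [α]) ++ z ++ (β :: t') := by simp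
    _ = _ := by rw [← hα, ← hβ]; simp

/-- Every word of the language can be extended to a point of `Σ`. -/
theorem exists_mem_sequences {z : List PascalLetter} (hz : z ∈ language) :
    ∃ x ∈ sequences, ∀ p (hp : p < z.length), x p = z[p] := by
  have : Nonempty PascalLetter := ⟨PascalLetter.a⟩
  choose! α β hαβ using fun (y : List PascalLetter) (hy : y ∈ language) =>
    exists_cons_append_mem_language hy
  -- Position `p` of the limit is read off in `Z i` at index `p + i`; the index
  -- `i = |p| + 1` is large enough even if `z` is empty.
  set Z : ℕ → List PascalLetter := fun i => Nat.rec z (fun _ y => α y :: (y ++ [β y])) i with hZ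
  have hZs : ∀ i, Z (i + 1) = α (Z i) :: (Z i ++ [β (Z i)]) := fun i => rfl
  have hZL : ∀ i, Z i ∈ language := by
    intro i
    induction i with
    | zero => exact hz
    | succ i ih => rw [hZs]; exact hαβ _ ih
  have hlen : ∀ i, (Z i).length = z.length + 2 * i := by
    intro i
    induction i with
    | zero => rfl
    | succ i ih => rw [hZs]; simp [ih]; omega
  have hget : ∀ i l q, q < (Z i).length → (Z (i + l))[q + l]? = (Z i)[q]? := by
    intro i l q hq
    induction l with
    | zero => rfl
    | succ l ih =>
      rw [← add_assoc, hZs, ← add_assoc, List.getElem?_cons_succ, List.getElem?_append_left, ih]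
      rw [hlen] at hq ⊢
      omega
  set x : ℤ → PascalLetter := fun p =>
    ((Z (p.natAbs + 1))[(p + p.natAbs + 1).toNat]?).getD PascalLetter.a with hx
  have hxZ : ∀ (p : ℤ) (i : ℕ), p.natAbs + 1 ≤ i → (Z i)[(p + i).toNat]? = some (x p) := by
    intro p i hi
    obtain ⟨l, rfl⟩ := Nat.exists_eq_add_of_le hi
    have hlt : (p + p.natAbs + 1).toNat < (Z (p.natAbs + 1)).length :=
      lt_of_lt_of_eq (by omega) (hlen (p.natAbs + 1)).symm
    have h1 := hget (p.natAbs + 1) l _ hlt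
    rw [show (p + ((p.natAbs + 1 + l : ℕ) : ℤ)).toNat = (p + p.natAbs + 1).toNat + l by omega, h1,
      hx]
    simp only [List.getElem?_eq_getElem hlt, Option.getD_some]
  refine ⟨x, fun m n => ?_, fun p hp => ?_⟩
  · set i := m.natAbs + n + 1
    refine mem_language_of_infix (hZL i) ?_
    have e : subword x m n = ((Z i).drop (m + i).toNat).take n := by
      refine List.ext_getElem? fun q => ?_
      rw [List.getElem?_take]
      split_ifs with hq
      · have := hxZ (m + q) i (by omega)
        rw [List.getElem?_drop, ← show (m + q + i).toNat = (m + i).toNat + q by omega, this]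
        simp [subword, hq]
      · simp [subword, hq]
    rw [e]
    exact (List.take_prefix _ _).isInfix.trans (List.drop_suffix _ _).isInfix
  · have h1 := hxZ p (p + 1) (by omega)
    have h2 := hget 0 (p + 1) p hp
    rw [zero_add] at h2
    rw [show ((p : ℤ) + ((p + 1 : ℕ) : ℤ)).toNat = p + (p + 1) by omega, h2] at h1
    exact (List.getElem?_eq_some_iff.1 h1).2.symm

/-- If the central words of `x` and `y` occur in one word of the language at positions `p` and
`q`, then some point of `Σ` is close to `x`, and its image under `σ ^ (q - p)` is close to `y`. -/
theorem exists_shift_zpow_agree {z : List PascalLetter} (hz : z ∈ language)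
    (x y : ℤ → PascalLetter) {M p q : ℕ} (hp : OccursAt (subword x (-M) (2 * M + 1)) z p)
    (hq : OccursAt (subword y (-M) (2 * M + 1)) z q) : ∃ x' : sequences,
      (∀ r : ℤ, r.natAbs ≤ M → x'.1 r = x r) ∧
      ∀ r : ℤ, r.natAbs ≤ M → ((shift ^ (q - p : ℤ)) x').1 r = y r := by
  obtain ⟨x₀, hx₀, h⟩ := exists_mem_sequences hz
  have key : ∀ (x : ℤ → PascalLetter) (p : ℕ), OccursAt (subword x (-M) (2 * M + 1)) z p →
      ∀ r : ℤ, r.natAbs ≤ M → x₀ (r + (p + M)) = x r := by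
    rintro x p ⟨s, t, rfl, rfl⟩ r hr
    obtain ⟨i, hi⟩ : ∃ i : ℕ, (i : ℤ) = r + M := ⟨(r + M).toNat, by omega⟩
    have hiu : i < (subword x (-M) (2 * M + 1)).length := by simp [subword]; omega
    have hz := h (s.length + i) (by simp; omega)
    rw [show r + ((s.length : ℤ) + M) = ((s.length + i : ℕ) : ℤ) by push_cast; omega, hz]
    rw [List.getElem_append_left (by simp; omega), List.getElem_append_right (by omega)]
    simp only [add_tsub_cancel_left, subword, List.getElem_ofFn]
    congr 1
    omega
  refine ⟨(shift ^ (p + M : ℤ)) ⟨x₀, hx₀⟩, fun r hr => ?_, fun r hr => ?_⟩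
  · rw [shift_zpow_apply]
    exact key x p hp r hr
  · rw [shift_zpow_apply, shift_zpow_apply, ← key y q hq r hr]
    rw [show r + ((q : ℤ) - p) + (p + M) = r + (q + M) by ring]

theorem exists_agree_subset {U : Set sequences} (hU : IsOpen U) {x : sequences} (hx : x ∈ U) :
    ∃ M : ℕ, ∀ M' ≥ M, ∀ x' : sequences, (∀ r : ℤ, r.natAbs ≤ M' → x'.1 r = x.1 r) → x' ∈ U := by
  obtain ⟨V, hV, rfl⟩ := isOpen_induced_iff.1 hU
  obtain ⟨I, u, hu, hsub⟩ := isOpen_pi_iff.1 hV x.1 hx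
  refine ⟨∑ i ∈ I, i.natAbs, fun M' hM' x' h => hsub fun i hi => ?_⟩
  rw [h i ((Finset.single_le_sum (f := fun i : ℤ => i.natAbs) (by simp) hi).trans hM')]
  exact (hu i hi).2

theorem exists_prod_agree_subset {U : Set (sequences × sequences)} (hU : IsOpen U)
    {x : sequences × sequences} (hx : x ∈ U) : ∃ M : ℕ, ∀ M' ≥ M, ∀ x' y' : sequences,
      (∀ r : ℤ, r.natAbs ≤ M' → x'.1 r = x.1.1 r) →
      (∀ r : ℤ, r.natAbs ≤ M' → y'.1 r = x.2.1 r) → (x', y') ∈ U := by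
  obtain ⟨U₁, U₂, h₁, h₂, hx₁, hx₂, hsub⟩ := isOpen_prod_iff.1 hU x.1 x.2 hx
  obtain ⟨M₁, hM₁⟩ := exists_agree_subset h₁ hx₁
  obtain ⟨M₂, hM₂⟩ := exists_agree_subset h₂ hx₂
  exact ⟨max M₁ M₂, fun M' hM' x' y' hx' hy' => hsub
    ⟨hM₁ M' (le_of_max_le_left hM') x' hx', hM₂ M' (le_of_max_le_right hM') y' hy'⟩⟩

theorem exists_common_zeta {u v : List PascalLetter} (hu : u ∈ language) (hv : v ∈ language) :
    ∃ n k p q, 0 < k ∧ k < n ∧ OccursAt u (zeta n k) p ∧ OccursAt v (zeta n k) q := by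
  obtain ⟨n, k, p, hk, hkn, hp⟩ := exists_occursAt_zeta hu
  obtain ⟨n', k', p', hk', hkn', hp'⟩ := exists_occursAt_zeta hv
  obtain ⟨q, q', hq, hq'⟩ := exists_occursAt_common hk hkn hk' hkn'
  exact ⟨n + n', k + k', _, _, by omega, by omega, hp.trans hq, hp'.trans hq'⟩

/-- Two pairs of words can be placed with the same offset between the words of each pair. All
four words are put into one basic word; the integer `c` passed to `exists_add_mem_gaps` corrects
the discrepancy between the offsets inside it. -/
theorem exists_common_gap {u₁ v₁ u₂ v₂ : List PascalLetter} (hu₁ : u₁ ∈ language)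
    (hv₁ : v₁ ∈ language) (hu₂ : u₂ ∈ language) (hv₂ : v₂ ∈ language) :
    ∃ z₁ ∈ language, ∃ z₂ ∈ language, ∃ p₁ q₁ p₂ q₂ : ℕ, OccursAt u₁ z₁ p₁ ∧ OccursAt v₁ z₁ q₁ ∧
      OccursAt u₂ z₂ p₂ ∧ OccursAt v₂ z₂ q₂ ∧ (q₁ : ℤ) - p₁ = q₂ - p₂ := by
  obtain ⟨n, k, a₁, b₁, hk, hkn, ha₁, hb₁⟩ := exists_common_zeta hu₁ hv₁
  obtain ⟨n', k', a₂, b₂, hk', hkn', ha₂, hb₂⟩ := exists_common_zeta hu₂ hv₂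
  obtain ⟨p, q, hp, hq⟩ := exists_occursAt_common hk hkn hk' hkn'
  obtain ⟨d, ⟨z₂, hz₂, i₂, j₂, hi₂, hj₂, hd₂⟩, ⟨z₁, hz₁, i₁, j₁, hi₁, hj₁, hd₁⟩⟩ :=
    exists_add_mem_gaps (n := n + n') (k := k + k') (by omega) (by omega)
      ((b₂ : ℤ) - a₂ - (b₁ - a₁))
  exact ⟨z₁, hz₁, z₂, hz₂, _, _, _, _, (ha₁.trans hp).trans hi₁, (hb₁.trans hp).trans hj₁,
    (ha₂.trans hq).trans hi₂, (hb₂.trans hq).trans hj₂, by push_cast; omega⟩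

theorem isTopologicallyWeaklyMixing_shift : IsTopologicallyWeaklyMixing shift := by
  obtain ⟨x₀, hx₀, -⟩ := exists_mem_sequences (zeta_mem_language le_rfl (Nat.zero_le 1))
  have : Nonempty (sequences × sequences) := ⟨(⟨x₀, hx₀⟩, ⟨x₀, hx₀⟩)⟩
  refine exists_dense_zpow_orbit _ ?_
  rintro U V hU ⟨x, hx⟩ hV ⟨y, hy⟩
  obtain ⟨M₁, hM₁⟩ := exists_prod_agree_subset hU hx
  obtain ⟨M₂, hM₂⟩ := exists_prod_agree_subset hV hy
  obtain ⟨M, h₁, h₂⟩ : ∃ M, M₁ ≤ M ∧ M₂ ≤ M := ⟨_, le_max_left _ _, le_max_right _ _⟩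
  obtain ⟨z₁, hz₁, z₂, hz₂, p₁, q₁, p₂, q₂, hp₁, hq₁, hp₂, hq₂, e⟩ :=
    exists_common_gap (x.1.2 (-M) (2 * M + 1)) (y.1.2 (-M) (2 * M + 1))
      (x.2.2 (-M) (2 * M + 1)) (y.2.2 (-M) (2 * M + 1))
  obtain ⟨x₁, hx₁, hy₁⟩ := exists_shift_zpow_agree hz₁ _ _ hp₁ hq₁
  obtain ⟨x₂, hx₂, hy₂⟩ := exists_shift_zpow_agree hz₂ _ _ hp₂ hq₂
  refine ⟨q₁ - p₁, (x₁, x₂), hM₁ M h₁ _ _ hx₁ hx₂, ?_⟩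
  rw [prodCongr_zpow_apply]
  refine hM₂ M h₂ _ _ hy₁ ?_
  rw [e]
  exact hy₂

end PascalSubshift

theorem theorem4p10 : IsTopologicallyWeaklyMixing PascalSubshift.shift := by
  exact PascalSubshift.isTopologicallyWeaklyMixing_shift
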